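/- All graphs are undirected and simple. A graph is an interval graph if its vertices can be assigned intervals of the real line so that two distinct vertices are adjacent if and only if their intervals intersect. A set $X$ of vertices of a graph $G$ is a minimal forbidden set if $G[X]$ is not an interval graph but $G[X']$ is an interval graph for every proper subset $X'\subset X$. The graph $G$ is prereduced if it has no minimal forbidden set of at most $10$ vertices. A $\dagger$-AW in $G$, written $(s:c:l,B,r)$ with $B=\{b_1,\dots,b_d\}$, $d\ge 3$, $b_0=l$, $b_{d+1}=r$, is an induced subgraph of $G$ on distinct vertices $s,c,b_0,\dots,b_{d+1}$ whose edges are exactly $b_ib_{i+1}$ ($0\le i\le d$), $sc$, and $cb_i$ ($1\le i\le d$). A $\ddagger$-AW in $G$, written $(s:c_1,c_2:l,B,r)$ with $B=\{b_1,\dots,b_d\}$, $d\ge 2$, $b_0=l$, $b_{d+1}=r$, is an induced subgraph of $G$ on distinct vertices $s,c_1,c_2,b_0,\dots,b_{d+1}$ whose edges are exactly $b_ib_{i+1}$ ($0\le i\le d$), $sc_1$, $sc_2$, $c_1c_2$, $c_1b_i$ ($0\le i\le d$), and $c_2b_i$ ($1\le i\le d+1$). In both cases $s$ is called the shallow terminal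 and $B$ the base. For a vertex $s$, $N(s)$ is its set of neighbors; for a vertex set $U$, $N(U)$ is the set of vertices outside $U$ with a neighbor in $U$. Theorem. Let $W$ be a $\dagger$-AW or a $\ddagger$-AW in a prereduced graph $G$, with shallow terminal $s$ and base $B$. Let $C=N(s)\cap N(B)$ and let $M$ be the vertex set of the component of $G-C$ containing $s$. Then every vertex of $M$ is adjacent to every vertex of $C$, and $C$ induces a clique in $G$. -/

import Mathlib

/-- `G` is an interval graph: the vertices can be assigned (nonempty, closed) intervals
`[l v, r v]` of the real line such that two distinct vertices are adjacent if and only if their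
intervals intersect. -/
def IsIntervalGraph {V : Type*} (G : SimpleGraph V) : Prop :=
  ∃ l r : V → ℝ, (∀ v, l v ≤ r v) ∧
    ∀ u v, u ≠ v →
      (G.Adj u v ↔ (Set.Icc (l u) (r u) ∩ Set.Icc (l v) (r v)).Nonempty)

/-- `X` is a minimal forbidden set of `G`: `X` does not induce an interval graph, but every
proper subset of `X` does. -/
def IsMinimalForbiddenSet {V : Type*} (G : SimpleGraph V) (X : Set V) : Prop :=
  ¬ IsIntervalGraph (G.induce X) ∧ ∀ Y : Set V, Y ⊂ X → IsIntervalGraph (G.induce Y)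

/-- `G` is prereduced: it has no minimal forbidden set of at most 10 vertices. -/
def IsPrereduced {V : Type*} (G : SimpleGraph V) : Prop :=
  ∀ X : Finset V, X.card ≤ 10 → ¬ IsMinimalForbiddenSet G (X : Set V)

/-- The base part shared by both kinds of asteroidal witnesses: `b 0, b 1, …, b (d + 1)` are
distinct vertices that induce a path of `G`, in this order
(`b 0` and `b (d + 1)` are the base terminals `l` and `r`). -/
def IsInducedPath {V : Type*} (G : SimpleGraph V) (d : ℕ) (b : Fin (d + 2) → V) : Prop :=
  Function.Injective b ∧
    ∀ i j : Fin (d + 2), G.Adj (b i) (b j) ↔ (i.val + 1 = j.val ∨ j.val + 1 = i.val)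

/-- The vertices `s`, `c`, `b 0, …, b (d + 1)` induce in `G` a dagger asteroidal witness
`(s : c : b 0, {b 1, …, b d}, b (d + 1))`, with shallow terminal `s`, center `c` and
`d ≥ 3` base vertices. -/
structure IsDaggerAW {V : Type*} (G : SimpleGraph V) (d : ℕ) (s c : V) (b : Fin (d + 2) → V) :
    Prop where
  three_le : 3 ≤ d
  path : IsInducedPath G d b
  s_ne : ∀ i, s ≠ b i
  c_ne : ∀ i, c ≠ b i
  adj_s_c : G.Adj s c
  not_adj_s : ∀ i, ¬ G.Adj s (b i)
  adj_c : ∀ i : Fin (d + 2), G.Adj c (b i) ↔ (1 ≤ i.val ∧ i.val ≤ d)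

/-- The vertices `s`, `c₁`, `c₂`, `b 0, …, b (d + 1)` induce in `G` a double-dagger asteroidal
witness `(s : c₁, c₂ : b 0, {b 1, …, b d}, b (d + 1))`, with shallow terminal `s`, centers
`c₁`, `c₂` and `d ≥ 2` base vertices. -/
structure IsDoubleDaggerAW {V : Type*} (G : SimpleGraph V) (d : ℕ) (s c₁ c₂ : V)
    (b : Fin (d + 2) → V) : Prop where
  two_le : 2 ≤ d
  path : IsInducedPath G d b
  s_ne : ∀ i, s ≠ b i
  c₁_ne : ∀ i, c₁ ≠ b i
  c₂_ne : ∀ i, c₂ ≠ b i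
  adj_s_c₁ : G.Adj s c₁
  adj_s_c₂ : G.Adj s c₂
  adj_c₁_c₂ : G.Adj c₁ c₂
  not_adj_s : ∀ i, ¬ G.Adj s (b i)
  adj_c₁ : ∀ i : Fin (d + 2), G.Adj c₁ (b i) ↔ i.val ≤ d
  adj_c₂ : ∀ i : Fin (d + 2), G.Adj c₂ (b i) ↔ 1 ≤ i.val

/-- The base `{b 1, …, b d}`. -/
def baseSet {V : Type*} (d : ℕ) (b : Fin (d + 2) → V) : Set V :=
  {v | ∃ i : Fin (d + 2), 1 ≤ i.val ∧ i.val ≤ d ∧ b i = v}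

/-- The neighborhood `N(U) = N[U] \ U` of a vertex set `U`. -/
def setNeighborhood {V : Type*} (G : SimpleGraph V) (U : Set V) : Set V :=
  {v | v ∉ U ∧ ∃ u ∈ U, G.Adj u v}

/-- The set `N(s) ∩ N(B)`. -/
def commonNeighborhood {V : Type*} (G : SimpleGraph V) (s : V) (B : Set V) : Set V :=
  G.neighborSet s ∩ setNeighborhood G B

theorem self_mem_compl_commonNeighborhood {V : Type*} (G : SimpleGraph V) (s : V) (B : Set V) :
    s ∈ (commonNeighborhood G s B)ᶜ :=
  fun h => G.loopless.irrefl s h.1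

/-- The vertex set, in `G`, of the component of `G - (N(s) ∩ N(B))` containing `s`. -/
def componentAvoiding {V : Type*} (G : SimpleGraph V) (s : V) (B : Set V) : Set V :=
  Subtype.val ''
    ((G.induce (commonNeighborhood G s B)ᶜ).connectedComponentMk
      ⟨s, self_mem_compl_commonNeighborhood G s B⟩).supp

/-! Prereducedness enters only through interval models of at most ten vertices, which exclude
induced four-cycles and asteroidal triples with short witnessing walks.

The crux is `IsWeakAW.adj_of_adj_base`: a neighbour x of s that sees the base is adjacent to every
other neighbour t of s. Otherwise t misses the path around both ends of a run of neighbours of x,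
and t forms an asteroidal triple with the two path vertices bounding the run. Since x shortcuts the
run, nine vertices suffice however long the base is.

The clique claim follows at once. Moreover, a neighbour of s outside C can replace s in the witness
without changing C, so adjacency to all of C spreads through M. -/

/-! ### Interval models of small vertex sets -/

section Prereduced

variable {V : Type*} {G : SimpleGraph V}

/-- In a prereduced graph every set of at most 10 vertices induces an interval graph. -/
theorem IsPrereduced.isIntervalGraph_induce (hG : IsPrereduced G) (X : Finset V)
    (hX : X.card ≤ 10) : IsIntervalGraph (G.induce (X : Set V)) := by
  induction X using Finset.strongInduction with
  | H X ih =>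
    by_contra hn
    refine hG X hX ⟨hn, fun Y hY => ?_⟩
    have hfin : Y.Finite := X.finite_toSet.subset hY.subset
    lift Y to Finset V using hfin
    have hYX : Y ⊂ X := by exact_mod_cast hY
    exact ih Y hYX ((Finset.card_le_card hYX.subset).trans hX)

theorem IsPrereduced.exists_intervals (hG : IsPrereduced G) (L : List V) (hL : L.length ≤ 10) :
    ∃ l r : V → ℝ, (∀ v, l v ≤ r v) ∧
      ∀ u ∈ L, ∀ v ∈ L, u ≠ v → (G.Adj u v ↔ l u ≤ r v ∧ l v ≤ r u) := by
  classical
  obtain ⟨l, r, hlr, h⟩ := hG.isIntervalGraph_induce L.toFinset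
    ((List.toFinset_card_le L).trans hL)
  -- The value 0 outside `L` is arbitrary; it only keeps `l v ≤ r v`.
  refine ⟨fun v => if hv : v ∈ (L.toFinset : Set V) then l ⟨v, hv⟩ else 0,
    fun v => if hv : v ∈ (L.toFinset : Set V) then r ⟨v, hv⟩ else 0, fun v => ?_,
    fun u hu v hv huv => ?_⟩
  · dsimp only
    split_ifs with hv
    · exact hlr _
    · exact le_rfl
  · have hu' : u ∈ (L.toFinset : Set V) := by simpa using hu
    have hv' : v ∈ (L.toFinset : Set V) := by simpa using hv
    have key := h ⟨u, hu'⟩ ⟨v, hv'⟩ (by simpa using huv)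
    rw [Set.Icc_inter_Icc, Set.nonempty_Icc, sup_le_iff, le_inf_iff, le_inf_iff] at key
    simp only [SimpleGraph.comap_adj, Function.Embedding.subtype_apply] at key
    simp only [dif_pos hu', dif_pos hv']
    rw [key]
    have := hlr ⟨u, hu'⟩
    have := hlr ⟨v, hv'⟩
    tauto

/-- A walk that avoids the closed neighbourhood of `c` stays on one side of the interval of `c`. -/
theorem walk_on_one_side {l r : V → ℝ} (hlr : ∀ v, l v ≤ r v) {c a : V} {P : List V}
    (h : ∀ u ∈ c :: a :: P, ∀ v ∈ c :: a :: P, u ≠ v → (G.Adj u v ↔ l u ≤ r v ∧ l v ≤ r u))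
    (hP : List.IsChain G.Adj (a :: P)) (hc : ∀ z ∈ a :: P, z ≠ c ∧ ¬ G.Adj z c) :
    (∀ z ∈ a :: P, r z < l c) ∨ (∀ z ∈ a :: P, r c < l z) := by
  have hside : r a < l c ∨ r c < l a := by
    have h1 := hc a (by simp)
    by_contra! hcon
    exact h1.2 ((h a (by simp) c (by simp) h1.1).2 ⟨hcon.2, hcon.1⟩)
  induction P generalizing a with
  | nil => simpa using hside
  | cons e P ih =>
    rw [List.isChain_cons_cons] at hP
    have hae := (h a (by simp) e (by simp) hP.1.ne).1 hP.1
    have hside' : r e < l c ∨ r c < l e := by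
      have h1 := hc e (by simp)
      by_contra! hcon
      exact h1.2 ((h e (by simp) c (by simp) h1.1).2 ⟨hcon.2, hcon.1⟩)
    have := hlr c
    refine (ih (fun u hu v hv => h u (by simp at hu ⊢; tauto) v (by simp at hv ⊢; tauto))
      hP.2 (fun z hz => hc z (List.mem_cons_of_mem _ hz)) hside').imp
      (fun h4 => ?_) (fun h4 => ?_) <;>
    · rintro z (_ | ⟨_, hz⟩)
      · have := h4 e (by simp)
        rcases hside with h5 | h5 <;> linarith
      · exact h4 z hz

/-- A prereduced graph has no asteroidal triple `a, b, c` whose witnessing walks use at most 10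
vertices. -/
theorem IsPrereduced.not_asteroidal (hG : IsPrereduced G) (L : List V) (hL : L.length ≤ 10)
    {a b c : V} (P Q R : List V) (hPL : a :: P ⊆ L) (hQL : b :: Q ⊆ L) (hRL : c :: R ⊆ L)
    (hP : List.IsChain G.Adj (a :: P)) (hQ : List.IsChain G.Adj (b :: Q))
    (hR : List.IsChain G.Adj (c :: R)) (hbP : b ∈ P) (hcQ : c ∈ Q) (haR : a ∈ R)
    (hcP : ∀ z ∈ a :: P, z ≠ c ∧ ¬ G.Adj z c) (haQ : ∀ z ∈ b :: Q, z ≠ a ∧ ¬ G.Adj z a)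
    (hbR : ∀ z ∈ c :: R, z ≠ b ∧ ¬ G.Adj z b) : False := by
  obtain ⟨l, r, hlr, h⟩ := hG.exists_intervals L hL
  have ha : a ∈ L := hPL (by simp)
  have hb : b ∈ L := hQL (by simp)
  have hc : c ∈ L := hRL (by simp)
  have restrict : ∀ {x y : V} {S : List V}, x ∈ L → y :: S ⊆ L →
      ∀ u ∈ x :: y :: S, ∀ v ∈ x :: y :: S, u ≠ v → (G.Adj u v ↔ l u ≤ r v ∧ l v ≤ r u) := by
    intro x y S hx hS u hu v hv
    have : x :: y :: S ⊆ L := List.cons_subset.2 ⟨hx, hS⟩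
    exact h u (this hu) v (this hv)
  have h1 := walk_on_one_side hlr (restrict hc hPL) hP hcP
  have h2 := walk_on_one_side hlr (restrict ha hQL) hQ haQ
  have h3 := walk_on_one_side hlr (restrict hb hRL) hR hbR
  have := hlr a
  have := hlr b
  have := hlr c
  -- Any two of the three intervals lie on the same side of the third, so none is in the middle.
  rcases h1 with h1 | h1 <;> rcases h2 with h2 | h2 <;> rcases h3 with h3 | h3 <;>
  · have := h1 a (by simp)
    have := h1 b (by simp [hbP])
    have := h2 b (by simp)
    have := h2 c (by simp [hcQ])
    have := h3 c (by simp)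
    have := h3 a (by simp [haR])
    linarith

/-- In a prereduced graph two nonadjacent neighbours `u, v` of `s` cannot be joined through a short
walk that avoids the closed neighbourhood of `s`. -/
theorem IsPrereduced.adj_of_walk (hG : IsPrereduced G) {s u v z : V} (Z : List V)
    (hZ : List.IsChain G.Adj (z :: Z)) (hL : (s :: u :: v :: z :: Z).length ≤ 10)
    (hsu : G.Adj s u) (hsv : G.Adj s v) (huv : u ≠ v) (huz : G.Adj u z) {w : V}
    (hw : w ∈ z :: Z) (hvw : G.Adj v w) (hs : ∀ y ∈ z :: Z, y ≠ s ∧ ¬ G.Adj y s) : G.Adj u v := by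
  obtain ⟨l, r, hlr, h⟩ := hG.exists_intervals _ hL
  have h1 := walk_on_one_side hlr (c := s) (fun x hx y hy => h x (by simp at hx ⊢; tauto) y
    (by simp at hy ⊢; tauto)) hZ hs
  have h2 := (h s (by simp) u (by simp) hsu.ne).1 hsu
  have h3 := (h s (by simp) v (by simp) hsv.ne).1 hsv
  have h4 := (h u (by simp) z (by simp) huz.ne).1 huz
  have h5 := (h v (by simp) w (by simp at hw ⊢; tauto) hvw.ne).1 hvw
  refine (h u (by simp) v (by simp) huv).2 ?_
  have := hlr s
  -- Both `u` and `v` meet `s` and the walk beside it, so both contain the endpoint of `s` on that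
  -- side.
  rcases h1 with h1 | h1 <;>
  · have := h1 z (by simp)
    have := h1 w hw
    constructor <;> linarith

theorem IsPrereduced.adj_of_square (hG : IsPrereduced G) {s u z v : V} (hsu : G.Adj s u)
    (huz : G.Adj u z) (hzv : G.Adj z v) (hvs : G.Adj v s) (hzs : z ≠ s) (hsz : ¬ G.Adj s z)
    (huv : u ≠ v) : G.Adj u v :=
  hG.adj_of_walk (s := s) [] (List.isChain_singleton z) (by simp) hsu hvs.symm huv huz
    (List.mem_singleton_self z) hzv.symm (by simpa [G.adj_comm z s] using ⟨hzs, hsz⟩)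

end Prereduced

/-- The configuration shared by both kinds of asteroidal witnesses: an induced path
`b 0, …, b (d + 1)`, a vertex `s` away from it, and two (possibly equal) neighbours `c₁`, `c₂` of
`s` adjacent to all of `b 1, …, b d`, with `c₁` away from `b (d + 1)` and `c₂` away from `b 0`. -/
structure IsWeakAW {V : Type*} (G : SimpleGraph V) (d : ℕ) (b : ℕ → V) (c₁ c₂ s : V) : Prop where
  two_le : 2 ≤ d
  inj : ∀ i j, i ≤ d + 1 → j ≤ d + 1 → (b i = b j ↔ i = j)
  adj : ∀ i j, i ≤ d + 1 → j ≤ d + 1 → (G.Adj (b i) (b j) ↔ i + 1 = j ∨ j + 1 = i)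
  adj_s_c₁ : G.Adj s c₁
  adj_s_c₂ : G.Adj s c₂
  s_ne : ∀ i, i ≤ d + 1 → s ≠ b i
  not_adj_s : ∀ i, i ≤ d + 1 → ¬ G.Adj s (b i)
  adj_c₁ : ∀ i, 1 ≤ i → i ≤ d → G.Adj c₁ (b i)
  adj_c₂ : ∀ i, 1 ≤ i → i ≤ d → G.Adj c₂ (b i)
  c₁_ne : c₁ ≠ b (d + 1)
  c₂_ne : c₂ ≠ b 0
  not_adj_c₁ : ¬ G.Adj c₁ (b (d + 1))
  not_adj_c₂ : ¬ G.Adj c₂ (b 0)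

/-! ### Neighbours of the shallow terminal along the path -/

namespace IsWeakAW

variable {V : Type*} {G : SimpleGraph V} {d : ℕ} {b : ℕ → V} {c₁ c₂ s : V}

/-- Reflection, so that only arguments at the left end are needed. -/
theorem symm (h : IsWeakAW G d b c₁ c₂ s) : IsWeakAW G d (fun i => b (d + 1 - i)) c₂ c₁ s where
  two_le := h.two_le
  inj i j hi hj := by rw [h.inj _ _ (by omega) (by omega)]; omega
  adj i j hi hj := by rw [h.adj _ _ (by omega) (by omega)]; omega
  adj_s_c₁ := h.adj_s_c₂
  adj_s_c₂ := h.adj_s_c₁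
  s_ne i _ := h.s_ne _ (by omega)
  not_adj_s i _ := h.not_adj_s _ (by omega)
  adj_c₁ i _ _ := h.adj_c₂ _ (by omega) (by omega)
  adj_c₂ i _ _ := h.adj_c₁ _ (by omega) (by omega)
  c₁_ne := by simpa using h.c₂_ne
  c₂_ne := by simpa using h.c₁_ne
  not_adj_c₁ := by simpa using h.not_adj_c₂
  not_adj_c₂ := by simpa using h.not_adj_c₁

theorem ne_of_adj (h : IsWeakAW G d b c₁ c₂ s) {x : V} (hsx : G.Adj s x) {i : ℕ}
    (hi : i ≤ d + 1) : x ≠ b i := by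
  rintro rfl
  exact h.not_adj_s i hi hsx

/-- A neighbour of `s` and of `b k`, but not of `b (k + 1)`, misses `b (k + 2)`. -/
theorem not_adj_add_two (hG : IsPrereduced G) (h : IsWeakAW G d b c₁ c₂ s) {x : V}
    (hsx : G.Adj s x) {k : ℕ} (hk : k + 2 ≤ d + 1) (hxk : G.Adj x (b k))
    (hr : ¬ G.Adj x (b (k + 1))) : ¬ G.Adj x (b (k + 2)) := by
  intro hx
  have := hG.adj_of_square (s := x) (u := b k) (z := b (k + 1)) (v := b (k + 2)) hxk
    ((h.adj _ _ (by omega) (by omega)).2 (by omega))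
    ((h.adj _ _ (by omega) (by omega)).2 (by omega)) hx.symm
    (h.ne_of_adj hsx (by omega)).symm hr
    (by rw [Ne, h.inj _ _ (by omega) (by omega)]; omega)
  rw [h.adj _ _ (by omega) (by omega)] at this
  omega

/-- Otherwise `s`, `b k` and `b (k + 4)` are the tips of a long claw centred at `b (k + 2)`. -/
theorem adj_pred_or_succ_of_interior (hG : IsPrereduced G) (h : IsWeakAW G d b c₁ c₂ s) {x : V}
    (hsx : G.Adj s x) {k : ℕ} (hkd : k + 4 ≤ d + 1) (hxk : G.Adj x (b (k + 2)))
    (hl : ¬ G.Adj x (b (k + 1))) (hr : ¬ G.Adj x (b (k + 3))) : False := by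
  have hrr := h.not_adj_add_two hG hsx (by omega) hxk hr
  have hll : ¬ G.Adj x (b k) := by
    have := h.symm.not_adj_add_two hG hsx (k := d - 1 - k) (by omega)
    rw [show d + 1 - (d - 1 - k) = k + 2 by omega, show d + 1 - (d - 1 - k + 1) = k + 1 by omega,
      show d + 1 - (d - 1 - k + 2) = k by omega] at this
    exact this hxk hl
  have hne := fun i hi => h.ne_of_adj (i := i) hsx hi
  have hs := fun i hi => (h.s_ne i hi).symm
  refine hG.not_asteroidal [s, x, b k, b (k + 1), b (k + 2), b (k + 3), b (k + 4)] (by simp)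
    (a := s) (b := b k) (c := b (k + 4)) [x, b (k + 2), b (k + 1), b k]
    [b (k + 1), b (k + 2), b (k + 3), b (k + 4)] [b (k + 3), b (k + 2), x, s]
    (by simp) (by simp) (by simp) ?_ ?_ ?_ (by simp) (by simp) (by simp) ?_ ?_ ?_ <;>
  simp (disch := omega) [h.adj, h.inj, hxk, hrr, hll, h.s_ne, hs, h.not_adj_s, G.adj_comm _ s,
    hsx, hxk.symm, hne] <;>
  omega

/-- The long claw may not fit at the end of the path; instead `c₂`, which misses `b 0`, gives the
walk back to `s`. -/
theorem adj_two_of_adj_one (hG : IsPrereduced G) (h : IsWeakAW G d b c₁ c₂ s) {x : V}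
    (hsx : G.Adj s x) (hx : G.Adj x (b 1)) : G.Adj x (b 2) := by
  have htwo := h.two_le
  by_contra hr
  have hne := fun i hi => h.ne_of_adj (i := i) hsx hi
  have hs := fun i hi => (h.s_ne i hi).symm
  have hc := (h.adj_c₂ 2 (by omega) (by omega)).symm
  by_cases hl : G.Adj x (b 0)
  · refine hG.not_asteroidal [s, x, c₂, b 0, b 1, b 2] (by simp)
      (a := s) (b := b 0) (c := b 2) [x, b 0] [b 1, b 2] [c₂, s]
      (by simp) (by simp) (by simp) ?_ ?_ ?_ (by simp) (by simp) (by simp) ?_ ?_ ?_ <;>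
    simp (disch := omega) [h.adj, h.inj, hl, hr, h.s_ne, hs, h.c₂_ne, h.not_adj_c₂, hc,
      h.not_adj_s, G.adj_comm _ s, hsx, hne, h.adj_s_c₂]
  · have hrr := h.not_adj_add_two hG hsx (k := 1) (by omega) hx hr
    refine hG.not_asteroidal [s, x, c₂, b 0, b 1, b 2, b 3] (by simp)
      (a := s) (b := b 0) (c := b 3) [x, b 1, b 0] [b 1, b 2, b 3] [b 2, c₂, s]
      (by simp) (by simp) (by simp) ?_ ?_ ?_ (by simp) (by simp) (by simp) ?_ ?_ ?_ <;>
    simp (disch := omega) [h.adj, h.inj, hrr, h.s_ne, hs, h.c₂_ne, h.not_adj_c₂, hc,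
      h.not_adj_s, G.adj_comm _ s, hsx, hx, hne, h.adj_s_c₂]

/-- A neighbour of the base has another neighbour next to it on the base. -/
theorem adj_pred_or_succ (hG : IsPrereduced G) (h : IsWeakAW G d b c₁ c₂ s) {x : V}
    (hsx : G.Adj s x) {k : ℕ} (hk : 1 ≤ k) (hkd : k ≤ d) (hxk : G.Adj x (b k)) :
    (2 ≤ k ∧ G.Adj x (b (k - 1))) ∨ (k + 1 ≤ d ∧ G.Adj x (b (k + 1))) := by
  have htwo := h.two_le
  rcases hk.eq_or_lt with rfl | hk
  · exact Or.inr ⟨by omega, h.adj_two_of_adj_one hG hsx hxk⟩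
  rcases hkd.eq_or_lt with rfl | hkd
  · have := h.symm.adj_two_of_adj_one hG hsx (by simpa using hxk)
    exact Or.inl ⟨hk, by simpa using this⟩
  obtain ⟨k, rfl⟩ := Nat.exists_eq_add_of_le' hk
  by_contra! hcon
  exact h.adj_pred_or_succ_of_interior hG hsx (by omega) hxk (hcon.1 hk) (hcon.2 hkd)

/-- The left end of the neighbourhood of `x` on the path, with a neighbour `g` of `s` that misses
the end but sees every neighbour of `x` in the base. -/
theorem exists_left_end (h : IsWeakAW G d b c₁ c₂ s) {x : V} (hsx : G.Adj s x) {k : ℕ}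
    (hk : 1 ≤ k) (hxk : G.Adj x (b k)) :
    ∃ i g, i + 1 ≤ k ∧ G.Adj x (b (i + 1)) ∧ G.Adj s g ∧ ¬ G.Adj g (b i) ∧
      (∀ m, 1 ≤ m → m ≤ d → G.Adj x (b m) → G.Adj g (b m)) ∧
      (2 ≤ k ∧ G.Adj x (b (k - 1)) → i + 2 ≤ k) := by
  induction k, hk using Nat.le_induction with
  | base =>
    -- If the run reaches `b 0`, then `x` need not miss the end, and `c₂` does so in its place.
    by_cases hx : G.Adj x (b 0)
    · exact ⟨0, c₂, le_rfl, hxk, h.adj_s_c₂, h.not_adj_c₂, fun m h1 h2 _ => h.adj_c₂ m h1 h2,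
        by omega⟩
    · exact ⟨0, x, le_rfl, hxk, hsx, hx, fun _ _ _ hm => hm, by omega⟩
  | succ k hk ih =>
    by_cases hx : G.Adj x (b k)
    · obtain ⟨i, g, h1, h2, h3, h4, h5, -⟩ := ih hx
      exact ⟨i, g, by omega, h2, h3, h4, h5, fun _ => by omega⟩
    · exact ⟨k, x, le_rfl, hxk, hsx, hx, fun _ _ _ hm => hm, fun hm => absurd hm.2 hx⟩

/-- The gap `i + 2 ≤ j` keeps `b (i + 1)` away from `b (j + 1)` and `b j` away from `b i`, as the
asteroidal triple requires. -/
theorem exists_ends (hG : IsPrereduced G) (h : IsWeakAW G d b c₁ c₂ s) {x : V}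
    (hsx : G.Adj s x) {k : ℕ} (hk : 1 ≤ k) (hkd : k ≤ d) (hxk : G.Adj x (b k)) :
    ∃ i j g₁ g₂, i + 2 ≤ j ∧ j + 1 ≤ d + 1 ∧ G.Adj x (b (i + 1)) ∧ G.Adj x (b j) ∧
      G.Adj s g₁ ∧ G.Adj s g₂ ∧ ¬ G.Adj g₁ (b (j + 1)) ∧ ¬ G.Adj g₂ (b i) ∧
      G.Adj g₁ (b (i + 1)) ∧ G.Adj g₂ (b j) := by
  obtain ⟨i, g₂, h1, h2, h3, h4, h5, h6⟩ := h.exists_left_end hsx hk hxk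
  obtain ⟨j, g₁, h1', h2', h3', h4', h5', h6'⟩ := h.symm.exists_left_end hsx (k := d + 1 - k)
    (by omega) (by rwa [Nat.sub_sub_self (by omega)])
  have hj := h5' (d - i) (by omega) (by omega)
  rw [show d + 1 - (d - i) = i + 1 by omega] at hj
  rw [show d + 1 - (j + 1) = d - j by omega] at h2'
  rw [show d + 1 - (d + 1 - k - 1) = k + 1 by omega] at h6'
  rw [show d + 1 - j = d - j + 1 by omega] at h4'
  refine ⟨i, d - j, g₁, g₂, ?_, by omega, h2, h2', h3', h3, h4', h4, hj h2,
    h5 _ (by omega) (by omega) h2'⟩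
  rcases h.adj_pred_or_succ hG hsx hk hkd hxk with hp | ⟨hp, hp'⟩
  · have := h6 hp
    omega
  · have := h6' ⟨by omega, hp'⟩
    omega

/-- A neighbour of `s` with a neighbour in the base is adjacent to all other neighbours of `s`. -/
theorem adj_of_adj_base (hG : IsPrereduced G) (h : IsWeakAW G d b c₁ c₂ s) {x t : V}
    (hsx : G.Adj s x) {k : ℕ} (hk : 1 ≤ k) (hkd : k ≤ d) (hxk : G.Adj x (b k))
    (hst : G.Adj s t) (htx : t ≠ x) : G.Adj t x := by
  obtain ⟨i, j, g₁, g₂, hij, hj, hxi, hxj, hsg₁, hsg₂, hg₁, hg₂, hgi, hgj⟩ :=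
    h.exists_ends hG hsx hk hkd hxk
  by_contra hn
  -- A path vertex seen by `t` that `x` sees, or that is next to one `x` sees, closes a four- or
  -- five-cycle through `s`, forcing `t` and `x` to be adjacent.
  have far : ∀ m, m ≤ d + 1 → G.Adj x (b m) → ¬ G.Adj t (b m) := fun m hm hxm htm =>
    hn (hG.adj_of_square hst htm hxm.symm hsx.symm (h.s_ne m hm).symm (h.not_adj_s m hm) htx)
  have far' : ∀ m n, m ≤ d + 1 → n ≤ d + 1 → G.Adj (b m) (b n) → G.Adj x (b m) →
      ¬ G.Adj t (b n) := fun m n hm hn' hmn hxm htn => by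
    refine hn (hG.adj_of_walk (s := s) (u := t) (v := x) (z := b n) (w := b m) [b m]
      (by simpa using hmn.symm) (by simp) hst hsx htx htn (by simp) hxm ?_)
    simp [(h.s_ne m hm).symm, (h.s_ne n hn').symm, h.not_adj_s m hm, h.not_adj_s n hn',
      G.adj_comm _ s]
  have hti := far _ (by omega) hxi
  have htj := far _ (by omega) hxj
  have hti' := far' (i + 1) i (by omega) (by omega)
    ((h.adj _ _ (by omega) (by omega)).2 (by omega)) hxi
  have htj' := far' j (j + 1) (by omega) (by omega)
    ((h.adj _ _ (by omega) (by omega)).2 (by omega)) hxj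
  have hne := fun m hm => h.ne_of_adj (i := m) hst hm
  have hne' := fun m hm => (h.ne_of_adj (i := m) hst hm).symm
  have hne₁ := fun m hm => h.ne_of_adj (i := m) hsg₁ hm
  have hne₂ := fun m hm => h.ne_of_adj (i := m) hsg₂ hm
  -- From `t` each end is reached through `s` and whichever of `g₁`, `g₂` misses the other end; `x`
  -- joins the ends away from `t`.
  refine hG.not_asteroidal [t, s, x, g₁, g₂, b i, b (i + 1), b j, b (j + 1)] (by simp)
    (a := t) (b := b i) (c := b (j + 1)) [s, g₁, b (i + 1), b i]
    [b (i + 1), x, b j, b (j + 1)] [b j, g₂, s, t]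
    (by simp) (by simp) (by simp) ?_ ?_ ?_ (by simp) (by simp) (by simp) ?_ ?_ ?_ <;>
  simp (disch := omega) [h.adj, h.inj, h.s_ne, h.not_adj_s, G.adj_comm _ t,
    hne, hne', hne₁, hne₂, hti, htj, hti', htj', hst.symm, hsg₁, hsg₂.symm, hgi, hgj.symm, hxi.symm, hxj,
    hg₁, hg₂, hn, htx.symm] <;>
  omega

/-! ### The common neighbourhood and the component -/

theorem mem_commonNeighborhood_iff (h : IsWeakAW G d b c₁ c₂ s) {B : Set V}
    (hB : ∀ v, v ∈ B ↔ ∃ i, 1 ≤ i ∧ i ≤ d ∧ b i = v) {x : V} :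
    x ∈ commonNeighborhood G s B ↔ G.Adj s x ∧ ∃ k, 1 ≤ k ∧ k ≤ d ∧ G.Adj x (b k) := by
  simp only [commonNeighborhood, setNeighborhood, Set.mem_inter_iff, SimpleGraph.mem_neighborSet,
    Set.mem_ofPred_eq]
  refine and_congr_right fun hsx => ⟨?_, ?_⟩
  · rintro ⟨-, u, hu, hux⟩
    obtain ⟨k, h1, h2, rfl⟩ := (hB u).1 hu
    exact ⟨k, h1, h2, hux.symm⟩
  · rintro ⟨k, h1, h2, hxk⟩
    refine ⟨fun hx => ?_, b k, (hB _).2 ⟨k, h1, h2, rfl⟩, hxk.symm⟩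
    obtain ⟨m, h3, h4, rfl⟩ := (hB x).1 hx
    exact h.not_adj_s m (by omega) hsx

theorem isClique_commonNeighborhood (hG : IsPrereduced G) (h : IsWeakAW G d b c₁ c₂ s) {B : Set V}
    (hB : ∀ v, v ∈ B ↔ ∃ i, 1 ≤ i ∧ i ≤ d ∧ b i = v) : G.IsClique (commonNeighborhood G s B) := by
  intro y hy x hx hyx
  obtain ⟨hsx, k, hk, hkd, hxk⟩ := (h.mem_commonNeighborhood_iff hB).1 hx
  exact h.adj_of_adj_base hG hsx hk hkd hxk ((h.mem_commonNeighborhood_iff hB).1 hy).1 hyx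

/-- Since `z` is adjacent to `c₂`, the four-cycle `z`, `c₂`, `b 1`, `b 0` would force `c₂` to see `b
0`. -/
theorem not_adj_zero (hG : IsPrereduced G) (h : IsWeakAW G d b c₁ c₂ s) {z : V}
    (hsz : G.Adj s z) (hz : ∀ k, 1 ≤ k → k ≤ d → ¬ G.Adj z (b k)) : ¬ G.Adj z (b 0) := by
  have htwo := h.two_le
  have hc := h.adj_c₂ 1 le_rfl (by omega)
  have hz1 := hz 1 le_rfl (by omega)
  intro hz0
  have hzc : z ≠ c₂ := by
    rintro rfl
    exact hz1 hc
  have := h.adj_of_adj_base hG h.adj_s_c₂ le_rfl (by omega) hc hsz hzc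
  refine h.not_adj_c₂ (hG.adj_of_square (s := z) this hc
    ((h.adj 1 0 (by omega) (by omega)).2 (by omega)) hz0.symm
    (h.ne_of_adj hsz (by omega)).symm hz1 h.c₂_ne)

/-- A neighbour of `s` without neighbours in the base may replace `s`. -/
theorem of_adj (hG : IsPrereduced G) (h : IsWeakAW G d b c₁ c₂ s) {z : V}
    (hsz : G.Adj s z) (hz : ∀ k, 1 ≤ k → k ≤ d → ¬ G.Adj z (b k)) : IsWeakAW G d b c₁ c₂ z := by
  have htwo := h.two_le
  have hc₁ := h.adj_c₁ 1 le_rfl (by omega)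
  have hc₂ := h.adj_c₂ 1 le_rfl (by omega)
  have hz1 := hz 1 le_rfl (by omega)
  refine { h with
    adj_s_c₁ := h.adj_of_adj_base hG h.adj_s_c₁ le_rfl (by omega) hc₁ hsz ?_
    adj_s_c₂ := h.adj_of_adj_base hG h.adj_s_c₂ le_rfl (by omega) hc₂ hsz ?_
    s_ne := fun i hi => h.ne_of_adj hsz hi
    not_adj_s := fun i hi => ?_ }
  · rintro rfl
    exact hz1 hc₁
  · rintro rfl
    exact hz1 hc₂
  · rcases Nat.eq_zero_or_pos i with rfl | hi0
    · exact h.not_adj_zero hG hsz hz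
    rcases hi.eq_or_lt with rfl | hi
    · have := h.symm.not_adj_zero hG hsz (fun k hk hkd => hz _ (by omega) (by omega))
      simpa using this
    · exact hz i hi0 (by omega)

/-- Each inclusion is `adj_of_adj_base`, with `z` and with `s` as shallow terminal. -/
theorem commonNeighborhood_eq_of_adj (hG : IsPrereduced G) (h : IsWeakAW G d b c₁ c₂ s)
    {B : Set V} (hB : ∀ v, v ∈ B ↔ ∃ i, 1 ≤ i ∧ i ≤ d ∧ b i = v) {z : V}
    (hsz : G.Adj s z) (hz : ∀ k, 1 ≤ k → k ≤ d → ¬ G.Adj z (b k)) :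
    commonNeighborhood G z B = commonNeighborhood G s B := by
  have h' := h.of_adj hG hsz hz
  ext x
  rw [h.mem_commonNeighborhood_iff hB, h'.mem_commonNeighborhood_iff hB]
  refine and_congr_left fun ⟨k, hk, hkd, hxk⟩ => ⟨fun hzx => ?_, fun hsx => ?_⟩
  · refine h'.adj_of_adj_base hG hzx hk hkd hxk hsz.symm ?_
    rintro rfl
    exact h.not_adj_s k (by omega) hxk
  · refine h.adj_of_adj_base hG hsx hk hkd hxk hsz ?_
    rintro rfl
    exact hz k hk hkd hxk

theorem component_complete (hG : IsPrereduced G) (h : IsWeakAW G d b c₁ c₂ s) {B : Set V}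
    (hB : ∀ v, v ∈ B ↔ ∃ i, 1 ≤ i ∧ i ≤ d ∧ b i = v) {y : V} (hy : y ∈ componentAvoiding G s B)
    {x : V} (hx : x ∈ commonNeighborhood G s B) : G.Adj y x := by
  obtain ⟨y, hy, rfl⟩ := hy
  have hreach := (SimpleGraph.ConnectedComponent.exact
    ((SimpleGraph.ConnectedComponent.mem_supp_iff _ _).1 hy)).symm
  rw [SimpleGraph.reachable_iff_reflTransGen] at hreach
  -- Carrying both facts along the walk, the next vertex lies outside C, hence has no neighbour in
  -- the base and can take over.
  have key : IsWeakAW G d b c₁ c₂ y.1 ∧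
      commonNeighborhood G y.1 B = commonNeighborhood G s B := by
    clear hy
    induction hreach with
    | refl => exact ⟨h, rfl⟩
    | @tail y z _ hyz ih =>
      obtain ⟨hAW, hC⟩ := ih
      have hadj : G.Adj y.1 z.1 := hyz
      have hz : ∀ k, 1 ≤ k → k ≤ d → ¬ G.Adj z.1 (b k) := fun k hk hkd hzk =>
        z.2 (hC.subset ((hAW.mem_commonNeighborhood_iff hB).2 ⟨hadj, k, hk, hkd, hzk⟩))
      exact ⟨hAW.of_adj hG hadj hz, (hAW.commonNeighborhood_eq_of_adj hG hB hadj hz).trans hC⟩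
  rw [← key.2] at hx
  exact hx.1

end IsWeakAW

/-! ### Reduction of both kinds of witness -/

section Witnesses

variable {V : Type*} {G : SimpleGraph V} {d : ℕ} {s : V} {b : Fin (d + 2) → V}

/-- `Fin.ofNat` wraps around, harmlessly: a weak witness only constrains indices up to `d + 1`. -/
theorem IsDaggerAW.isWeakAW {c : V} (h : IsDaggerAW G d s c b) :
    IsWeakAW G d (fun i => b (Fin.ofNat (d + 2) i)) c c s where
  two_le := by have := h.three_le; omega
  inj i j hi hj := by
    rw [h.path.1.eq_iff, Fin.ext_iff, Fin.val_ofNat, Fin.val_ofNat, Nat.mod_eq_of_lt (by omega),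
      Nat.mod_eq_of_lt (by omega)]
  adj i j hi hj := by
    rw [h.path.2, Fin.val_ofNat, Fin.val_ofNat, Nat.mod_eq_of_lt (by omega),
      Nat.mod_eq_of_lt (by omega)]
  adj_s_c₁ := h.adj_s_c
  adj_s_c₂ := h.adj_s_c
  s_ne i _ := h.s_ne _
  not_adj_s i _ := h.not_adj_s _
  adj_c₁ i h1 hi := by
    rw [h.adj_c, Fin.val_ofNat, Nat.mod_eq_of_lt (by omega)]
    exact ⟨h1, hi⟩
  adj_c₂ i h1 hi := by
    rw [h.adj_c, Fin.val_ofNat, Nat.mod_eq_of_lt (by omega)]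
    exact ⟨h1, hi⟩
  c₁_ne := h.c_ne _
  c₂_ne := h.c_ne _
  not_adj_c₁ := by
    rw [h.adj_c, Fin.val_ofNat, Nat.mod_eq_of_lt (by omega)]
    omega
  not_adj_c₂ := by
    rw [h.adj_c, Fin.val_ofNat, Nat.mod_eq_of_lt (by omega)]
    omega

theorem IsDoubleDaggerAW.isWeakAW {c₁ c₂ : V} (h : IsDoubleDaggerAW G d s c₁ c₂ b) :
    IsWeakAW G d (fun i => b (Fin.ofNat (d + 2) i)) c₁ c₂ s where
  two_le := h.two_le
  inj i j hi hj := by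
    rw [h.path.1.eq_iff, Fin.ext_iff, Fin.val_ofNat, Fin.val_ofNat, Nat.mod_eq_of_lt (by omega),
      Nat.mod_eq_of_lt (by omega)]
  adj i j hi hj := by
    rw [h.path.2, Fin.val_ofNat, Fin.val_ofNat, Nat.mod_eq_of_lt (by omega),
      Nat.mod_eq_of_lt (by omega)]
  adj_s_c₁ := h.adj_s_c₁
  adj_s_c₂ := h.adj_s_c₂
  s_ne i _ := h.s_ne _
  not_adj_s i _ := h.not_adj_s _
  adj_c₁ i h1 hi := by
    rw [h.adj_c₁, Fin.val_ofNat, Nat.mod_eq_of_lt (by omega)]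
    exact hi
  adj_c₂ i h1 hi := by
    rw [h.adj_c₂, Fin.val_ofNat, Nat.mod_eq_of_lt (by omega)]
    exact h1
  c₁_ne := h.c₁_ne _
  c₂_ne := h.c₂_ne _
  not_adj_c₁ := by
    rw [h.adj_c₁, Fin.val_ofNat, Nat.mod_eq_of_lt (by omega)]
    omega
  not_adj_c₂ := by
    rw [h.adj_c₂, Fin.val_ofNat, Nat.mod_eq_of_lt (by omega)]
    omega

theorem mem_baseSet_iff (v : V) :
    v ∈ baseSet d b ↔ ∃ i, 1 ≤ i ∧ i ≤ d ∧ b (Fin.ofNat (d + 2) i) = v := by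
  constructor
  · rintro ⟨i, h1, h2, rfl⟩
    exact ⟨i.val, h1, h2, by simp⟩
  · rintro ⟨i, h1, h2, rfl⟩
    refine ⟨Fin.ofNat (d + 2) i, ?_, ?_, rfl⟩ <;>
    rwa [Fin.val_ofNat, Nat.mod_eq_of_lt (by omega)]

end Witnesses

theorem theorem5 {V : Type*} (G : SimpleGraph V) (hG : IsPrereduced G)
    (d : ℕ) (s : V) (b : Fin (d + 2) → V)
    (hW : (∃ c : V, IsDaggerAW G d s c b) ∨ (∃ c₁ c₂ : V, IsDoubleDaggerAW G d s c₁ c₂ b)) :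
    (∀ y ∈ componentAvoiding G s (baseSet d b),
      ∀ x ∈ commonNeighborhood G s (baseSet d b), G.Adj y x) ∧
    G.IsClique (commonNeighborhood G s (baseSet d b)) := by
  obtain ⟨c₁, c₂, h⟩ : ∃ c₁ c₂, IsWeakAW G d (fun i => b (Fin.ofNat (d + 2) i)) c₁ c₂ s := by
    rcases hW with ⟨c, h⟩ | ⟨c₁, c₂, h⟩
    · exact ⟨c, c, h.isWeakAW⟩
    · exact ⟨c₁, c₂, h.isWeakAW⟩
  exact ⟨fun y hy x hx => h.component_complete hG mem_baseSet_iff hy hx,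
    h.isClique_commonNeighborhood hG mem_baseSet_iff⟩
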